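/- For an integer $n\ge 5$ let $R(g^{2}_{(n,1)},2)$ be the complex Lie algebra with basis $e_1,\dots,e_n,x,y$ and products $$[e_1,e_i]=e_{i+1}\ (2\le i\le n-2),\qquad [e_i,e_n]=e_{i+2}\ (2\le i\le n-3),$$ $$[e_1,x]=e_1,\qquad [e_i,x]=(i-2)e_i,\quad [e_i,y]=e_i\ (2\le i\le n-1),\qquad [e_n,x]=2e_n,$$ and, if moreover $n$ is odd, let $R(g^{1}_{(n,1)},2)$ be the complex Lie algebra with basis $e_1,\dots,e_n,x,y$ and products $$[e_1,e_i]=e_{i+1}\ (2\le i\le n-2),\qquad [e_i,e_{n-i}]=(-1)^i e_n\ \left(2\le i\le \tfrac{n-1}{2}\right),$$ $$[e_1,x]=e_1,\qquad [e_i,x]=(i-2)e_i,\quad [e_i,y]=e_i\ (2\le i\le n-1),\qquad [e_n,x]=(n-4)e_n,\qquad [e_n,y]=2e_n.$$ In both cases the products in the opposite order are determined by antisymmetry and all products of basis elements not listed are zero. (These are solvable Lie algebras whose nilradical is spanned by $e_1,\dots,e_n$, with two-dimensional complement spanned by $x,y$.) For a Lie algebra $R$ let $H^2(R,R)$ be the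 second Chevalley--Eilenberg cohomology of $R$ with coefficients in the adjoint module: alternating bilinear maps $\varphi:R\times R\to R$ with $$[u,\varphi(v,w)]-[v,\varphi(u,w)]+[w,\varphi(u,v)]-\varphi([u,v],w)+\varphi([u,w],v)-\varphi([v,w],u)=0,$$ modulo the maps $(u,v)\mapsto [u,f(v)]-[v,f(u)]-f([u,v])$ with $f:R\to R$ linear. **Theorem.** $H^2\big(R(g^{1}_{(n,1)},2),R(g^{1}_{(n,1)},2)\big)=\{0\}$ for every odd $n\ge5$, and $H^2\big(R(g^{2}_{(n,1)},2),R(g^{2}_{(n,1)},2)\big)=\{0\}$ for every $n\ge5$. -/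

import Mathlib

set_option maxSynthPendingDepth 3

open Module

/-- The bilinear product on `ℂ^ι` given by a table of multiplication on the standard basis `b`.
Here `listed i j` is the product `[b i, b j]`
as far as it is listed in the table of a Lie algebra (each unordered pair is listed at most once);
the products in the opposite order are the negatives, all other products are zero. -/
noncomputable def tableMul {ι : Type} [Fintype ι] [DecidableEq ι] (listed : ι → ι → (ι → ℂ)) :
    (ι → ℂ) →ₗ[ℂ] (ι → ℂ) →ₗ[ℂ] (ι → ℂ) :=
  (Pi.basisFun ℂ ι).constr ℂ fun i =>
    (Pi.basisFun ℂ ι).constr ℂ fun j => listed i j - listed j i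

theorem tableMul_basis {ι : Type} [Fintype ι] [DecidableEq ι] (listed : ι → ι → (ι → ℂ))
    (i j : ι) :
    tableMul listed (Pi.basisFun ℂ ι i) (Pi.basisFun ℂ ι j) = listed i j - listed j i := by
  unfold tableMul
  rw [Basis.constr_basis, Basis.constr_basis]

theorem tableMul_skew {ι : Type} [Fintype ι] [DecidableEq ι] (listed : ι → ι → (ι → ℂ))
    (u v : ι → ℂ) : tableMul listed u v = - tableMul listed v u := by
  have h : tableMul listed = -(tableMul listed).flip := by
    refine (Pi.basisFun ℂ ι).ext fun i => (Pi.basisFun ℂ ι).ext fun j => ?_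
    rw [LinearMap.neg_apply, LinearMap.neg_apply, LinearMap.flip_apply, tableMul_basis,
      tableMul_basis, neg_sub]
  have h2 := congrArg (fun f => f u v) h
  simpa using h2

/-- A table of multiplication whose products satisfy the Jacobi identity on basis elements. -/
structure LieTable (ι : Type) [Fintype ι] [DecidableEq ι] where
  listed : ι → ι → (ι → ℂ)
  jacobi : ∀ i j k : ι,
    tableMul listed (listed i j - listed j i) (Pi.basisFun ℂ ι k) +
    tableMul listed (listed j k - listed k j) (Pi.basisFun ℂ ι i) +
    tableMul listed (listed k i - listed i k) (Pi.basisFun ℂ ι j) = 0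

theorem LieTable.jacobi' {ι : Type} [Fintype ι] [DecidableEq ι] (T : LieTable ι)
    (u v w : ι → ℂ) :
    tableMul T.listed (tableMul T.listed u v) w + tableMul T.listed (tableMul T.listed v w) u +
      tableMul T.listed (tableMul T.listed w u) v = 0 := by
  set M := tableMul T.listed with hM
  induction (Pi.basisFun ℂ ι).mem_span u using Submodule.span_induction with
  | mem _ hu =>
    obtain ⟨i, rfl⟩ := hu
    induction (Pi.basisFun ℂ ι).mem_span v using Submodule.span_induction with
    | mem _ hv =>
      obtain ⟨j, rfl⟩ := hv
      induction (Pi.basisFun ℂ ι).mem_span w using Submodule.span_induction with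
      | mem _ hw =>
        obtain ⟨k, rfl⟩ := hw
        rw [hM, tableMul_basis, tableMul_basis, tableMul_basis]
        exact T.jacobi i j k
      | zero => simp
      | add a b _ _ ha hb =>
        have := congrArg₂ (· + ·) ha hb
        simp only [map_add, LinearMap.add_apply, add_zero] at this ⊢
        rw [← this]; abel
      | smul c a _ ha =>
        have := congrArg (c • ·) ha
        simpa [smul_add] using this
    | zero => simp
    | add a b _ _ ha hb =>
      have := congrArg₂ (· + ·) ha hb
      simp only [map_add, LinearMap.add_apply, add_zero] at this ⊢
      rw [← this]; abel
    | smul c a _ ha =>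
      have := congrArg (c • ·) ha
      simpa [smul_add] using this
  | zero => simp
  | add a b _ _ ha hb =>
    have := congrArg₂ (· + ·) ha hb
    simp only [map_add, LinearMap.add_apply, add_zero] at this ⊢
    rw [← this]; abel
  | smul c a _ ha =>
    have := congrArg (c • ·) ha
    simpa [smul_add] using this

/-- The complex Lie algebra on `ℂ^ι` given by a table of multiplication. -/
def LieTable.Alg {ι : Type} [Fintype ι] [DecidableEq ι] (_ : LieTable ι) : Type := ι → ℂ

noncomputable section

instance {ι : Type} [Fintype ι] [DecidableEq ι] (T : LieTable ι) : AddCommGroup T.Alg :=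
  inferInstanceAs (AddCommGroup (ι → ℂ))

instance {ι : Type} [Fintype ι] [DecidableEq ι] (T : LieTable ι) : Module ℂ T.Alg :=
  inferInstanceAs (Module ℂ (ι → ℂ))

/-- The standard basis of the algebra. -/
def LieTable.basis {ι : Type} [Fintype ι] [DecidableEq ι] (T : LieTable ι) :
    Basis ι ℂ T.Alg :=
  Pi.basisFun ℂ ι

/-- The product of the algebra. -/
def LieTable.mul {ι : Type} [Fintype ι] [DecidableEq ι] (T : LieTable ι) :
    T.Alg →ₗ[ℂ] T.Alg →ₗ[ℂ] T.Alg :=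
  tableMul T.listed

theorem LieTable.mul_skew {ι : Type} [Fintype ι] [DecidableEq ι] (T : LieTable ι)
    (u v : T.Alg) : T.mul u v = - T.mul v u :=
  tableMul_skew T.listed u v

theorem LieTable.mul_jacobi {ι : Type} [Fintype ι] [DecidableEq ι] (T : LieTable ι)
    (u v w : T.Alg) :
    T.mul (T.mul u v) w + T.mul (T.mul v w) u + T.mul (T.mul w u) v = 0 :=
  T.jacobi' u v w

instance {ι : Type} [Fintype ι] [DecidableEq ι] (T : LieTable ι) : LieRing T.Alg where
  bracket u v := T.mul u v
  add_lie u v w := by change T.mul (u + v) w = T.mul u w + T.mul v w; simp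
  lie_add u v w := by change T.mul u (v + w) = T.mul u v + T.mul u w; simp
  lie_self u := by
    change T.mul u u = 0
    have h := T.mul_skew u u
    have h2 : (2 : ℂ) • T.mul u u = 0 := by
      rw [two_smul]; nth_rewrite 1 [h]; exact neg_add_cancel _
    exact (smul_eq_zero.mp h2).resolve_left two_ne_zero
  leibniz_lie u v w := by
    change T.mul u (T.mul v w) = T.mul (T.mul u v) w + T.mul v (T.mul u w)
    have h := T.mul_jacobi u v w
    rw [T.mul_skew (T.mul v w) u, T.mul_skew (T.mul w u) v, T.mul_skew w u, map_neg,
      neg_neg] at h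
    rw [eq_comm, ← sub_eq_zero, ← h]; abel

instance {ι : Type} [Fintype ι] [DecidableEq ι] (T : LieTable ι) : LieAlgebra ℂ T.Alg where
  lie_smul c u v := by change T.mul u (c • v) = c • T.mul u v; simp

theorem LieTable.lie_basis {ι : Type} [Fintype ι] [DecidableEq ι] (T : LieTable ι) (i j : ι) :
    ⁅T.basis i, T.basis j⁆ = (T.listed i j - T.listed j i : ι → ℂ) :=
  tableMul_basis T.listed i j

/-- The second Chevalley–Eilenberg cohomology of the Lie algebra `L` with coefficients in the
adjoint module `L`: alternating 2-cocycles modulo coboundaries of linear maps `L → L`. -/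
abbrev AdjointH2 (K L : Type) [CommRing K] [LieRing L] [LieAlgebra K L] : Type :=
  LieModule.Cohomology.twoCocycle K L L ⧸
    (LinearMap.range (LieModule.Cohomology.d₁₂ K L L)).submoduleOf
      (LieModule.Cohomology.twoCocycle K L L)

/-- Labels of the basis `e_1, …, e_n, x, y`. Here `inl i` is the label of `e_{i+1}`, while
`inr 0` and `inr 1` are the labels of `x` and `y`. -/
abbrev Lab (n : ℕ) : Type := Fin n ⊕ Fin 2

/-- The basis vector `e_k` for `1 ≤ k ≤ n` (and `0` for other `k`). -/
def eVec (n k : ℕ) : Lab n → ℂ :=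
  Sum.elim (fun i => if (i : ℕ) + 1 = k then 1 else 0) (fun _ => 0)

/-- Products `[e_a, e_b]` listed in the table of the nilradical `g¹_{(n,1)}`:
`[e_1, e_i] = e_{i+1}` for `2 ≤ i ≤ n - 2` and
`[e_i, e_{n-i}] = (-1)^i e_n` for `2 ≤ i ≤ (n - 1) / 2`. -/
def nil1 (n a b : ℕ) : Lab n → ℂ :=
  if a = 1 ∧ 2 ≤ b ∧ b + 2 ≤ n then eVec n (b + 1)
  else if 2 ≤ a ∧ 2 * a + 1 ≤ n ∧ a + b = n then (-1 : ℂ) ^ a • eVec n n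
  else 0

/-- Products `[e_a, e_b]` listed in the table of the nilradical `g²_{(n,1)}`:
`[e_1, e_i] = e_{i+1}` for `2 ≤ i ≤ n - 2` and `[e_i, e_n] = e_{i+2}` for `2 ≤ i ≤ n - 3`. -/
def nil2 (n a b : ℕ) : Lab n → ℂ :=
  if a = 1 ∧ 2 ≤ b ∧ b + 2 ≤ n then eVec n (b + 1)
  else if 2 ≤ a ∧ a + 3 ≤ n ∧ b = n then eVec n (a + 2)
  else 0

/-- `[e_k, x] = wtX n k p • e_k`, where `p` is the value for `k = n`. -/
def wtX (n k : ℕ) (p : ℂ) : ℂ :=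
  if k = 1 then 1 else if k = n then p else (k : ℂ) - 2

/-- `[e_k, y] = wtY n k q • e_k`, where `q` is the value for `k = n`. -/
def wtY (n k : ℕ) (q : ℂ) : ℂ :=
  if k = 1 then 0 else if k = n then q else 1

/-- Table on `e_1, …, e_n, x, y` with the products `nil` on `e_1, …, e_n` and with
`[e_k, x]`, `[e_k, y]` multiples of `e_k`. -/
def listedTable (n : ℕ) (nil : ℕ → ℕ → (Lab n → ℂ)) (p q : ℂ) : Lab n → Lab n → (Lab n → ℂ)
  | .inl i, .inl j => nil (i + 1) (j + 1)
  | .inl i, .inr s =>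
      (if s = 0 then wtX n (i + 1) p else wtY n (i + 1) q) • eVec n (i + 1)
  | .inr _, _ => 0

/-- The listed products of `R(g¹_{(n,1)}, 2)`. -/
def listed1 (n : ℕ) : Lab n → Lab n → (Lab n → ℂ) :=
  listedTable n (nil1 n) ((n : ℂ) - 4) 2

/-- The listed products of `R(g²_{(n,1)}, 2)`. -/
def listed2 (n : ℕ) : Lab n → Lab n → (Lab n → ℂ) :=
  listedTable n (nil2 n) 2 0

theorem eVec_eq (n : ℕ) (i : Fin n) : eVec n (i + 1) = Pi.basisFun ℂ (Lab n) (.inl i) := by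
  ext l
  rcases l with l | l
  · simp [eVec, Pi.single_apply, Fin.ext_iff]
  · simp [eVec]


/-- The basis vectors `x` (for `s = 0`) and `y` (for `s = 1`). -/
def qVec (n : ℕ) (s : Fin 2) : Lab n → ℂ := Pi.basisFun ℂ (Lab n) (.inr s)

/-- The weight of `e_k` for `x` (for `s = 0`) and `y` (for `s = 1`). -/
def wtQ (n : ℕ) (p q : ℂ) (s : Fin 2) (k : ℕ) : ℂ :=
  if s = 0 then wtX n k p else wtY n k q

theorem mul_ee (n : ℕ) (nil : ℕ → ℕ → (Lab n → ℂ)) (p q : ℂ) (a b : ℕ)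
    (ha : 1 ≤ a ∧ a ≤ n) (hb : 1 ≤ b ∧ b ≤ n) :
    tableMul (listedTable n nil p q) (eVec n a) (eVec n b) = nil a b - nil b a := by
  obtain ⟨a, rfl⟩ : ∃ c, a = c + 1 := ⟨a - 1, by omega⟩
  obtain ⟨b, rfl⟩ : ∃ c, b = c + 1 := ⟨b - 1, by omega⟩
  have h1 := eVec_eq n ⟨a, by omega⟩
  have h2 := eVec_eq n ⟨b, by omega⟩
  simp only at h1 h2
  rw [h1, h2, tableMul_basis]
  rfl

theorem mul_eq (n : ℕ) (nil : ℕ → ℕ → (Lab n → ℂ)) (p q : ℂ) (a : ℕ) (s : Fin 2)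
    (ha : 1 ≤ a ∧ a ≤ n) :
    tableMul (listedTable n nil p q) (eVec n a) (qVec n s) = wtQ n p q s a • eVec n a := by
  obtain ⟨a, rfl⟩ : ∃ c, a = c + 1 := ⟨a - 1, by omega⟩
  have h1 := eVec_eq n ⟨a, by omega⟩
  simp only at h1
  rw [h1, qVec, tableMul_basis, ← h1]
  simp [listedTable, wtQ]

/-- The Jacobi identity for a table, from the identity on `e_1, …, e_n` and the additivity of
weights. -/
theorem jacobi_listedTable (n : ℕ) (nil : ℕ → ℕ → (Lab n → ℂ)) (p q : ℂ)
    (hw : ∀ a b s, (1 ≤ a ∧ a ≤ n) → (1 ≤ b ∧ b ≤ n) →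
      tableMul (listedTable n nil p q) (nil a b) (qVec n s) =
        (wtQ n p q s a + wtQ n p q s b) • nil a b)
    (hn : ∀ a b c, (1 ≤ a ∧ a ≤ n) → (1 ≤ b ∧ b ≤ n) → (1 ≤ c ∧ c ≤ n) →
      tableMul (listedTable n nil p q) (nil a b - nil b a) (eVec n c) +
      tableMul (listedTable n nil p q) (nil b c - nil c b) (eVec n a) +
      tableMul (listedTable n nil p q) (nil c a - nil a c) (eVec n b) = 0)
    (i j k : Lab n) :
    tableMul (listedTable n nil p q) (listedTable n nil p q i j - listedTable n nil p q j i)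
      (Pi.basisFun ℂ (Lab n) k) +
    tableMul (listedTable n nil p q) (listedTable n nil p q j k - listedTable n nil p q k j)
      (Pi.basisFun ℂ (Lab n) i) +
    tableMul (listedTable n nil p q) (listedTable n nil p q k i - listedTable n nil p q i k)
      (Pi.basisFun ℂ (Lab n) j) = 0 := by
  have r : ∀ i : Fin n, 1 ≤ (i : ℕ) + 1 ∧ (i : ℕ) + 1 ≤ n := fun i => ⟨by omega, i.2⟩
  have hq : ∀ s, Pi.basisFun ℂ (Lab n) (.inr s) = qVec n s := fun s => rfl
  have l1 : ∀ i j : Fin n, listedTable n nil p q (.inl i) (.inl j) = nil (i + 1) (j + 1) :=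
    fun i j => rfl
  have l2 : ∀ (i : Fin n) s, listedTable n nil p q (.inl i) (.inr s) =
    wtQ n p q s (i + 1) • eVec n (i + 1) := fun i s => rfl
  have l3 : ∀ s (j : Lab n), listedTable n nil p q (.inr s) j = 0 := fun s j => rfl
  rcases i with i | i <;> rcases j with j | j <;> rcases k with k | k <;>
    simp only [← eVec_eq, hq, l1, l2, l3, sub_zero, zero_sub, map_neg, map_smul, map_sub,
      LinearMap.sub_apply, LinearMap.neg_apply, LinearMap.smul_apply, map_zero,
      LinearMap.zero_apply, sub_self,
      mul_ee n nil p q _ _ (r _) (r _), mul_eq n nil p q _ _ (r _), hw _ _ _ (r _) (r _)]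
  · have := hn (i + 1) (j + 1) (k + 1) (r i) (r j) (r k)
    simpa only [map_sub, LinearMap.sub_apply] using this
  all_goals module

/-- The products of `g¹_{(n,1)}` on basis elements, in either order. -/
theorem nil1_sub (n a b : ℕ) (hodd : Odd n) : nil1 n a b - nil1 n b a =
    if a = 1 ∧ 2 ≤ b ∧ b + 2 ≤ n then eVec n (b + 1)
    else if b = 1 ∧ 2 ≤ a ∧ a + 2 ≤ n then -eVec n (a + 1)
    else if 2 ≤ a ∧ 2 ≤ b ∧ a + b = n then (-1 : ℂ) ^ a • eVec n n else 0 := by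
  obtain ⟨m, hm⟩ := hodd
  unfold nil1
  split_ifs with h1 h2 h3 h4 h5 h6 h7 h8 h9 h10 h11 <;> first | (exfalso; omega) | simp
  rw [← neg_smul]
  congr 1
  have : (-1 : ℂ) ^ (a + b) = -1 := by
    rw [show a + b = 2 * m + 1 by omega, pow_succ, pow_mul]; simp
  rw [pow_add] at this
  have h : (-1 : ℂ) ^ b * (-1) ^ b = 1 := by rw [← mul_pow]; simp
  linear_combination (-1 : ℂ) ^ a * h - (-1) ^ b * this

theorem mul_nil1 (n : ℕ) (hn : 5 ≤ n) (hodd : Odd n) (p q : ℂ) (a b c : ℕ)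
    (hc : 1 ≤ c ∧ c ≤ n) :
    tableMul (listedTable n (nil1 n) p q) (nil1 n a b - nil1 n b a) (eVec n c) =
    if a = 1 ∧ 2 ≤ b ∧ b + 2 ≤ n then
      (if c = 1 ∧ b + 3 ≤ n then -eVec n (b + 2)
       else if 2 ≤ c ∧ b + 1 + c = n then -((-1 : ℂ) ^ b • eVec n n) else 0)
    else if b = 1 ∧ 2 ≤ a ∧ a + 2 ≤ n then
      -(if c = 1 ∧ a + 3 ≤ n then -eVec n (a + 2)
       else if 2 ≤ c ∧ a + 1 + c = n then -((-1 : ℂ) ^ a • eVec n n) else 0)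
    else 0 := by
  rw [nil1_sub n a b hodd]
  split_ifs <;> try simp only [map_neg, map_smul, LinearMap.neg_apply, LinearMap.smul_apply, map_zero,
    LinearMap.zero_apply]
  all_goals
    rw [mul_ee n (nil1 n) p q _ _ (by omega) hc, nil1_sub n _ _ hodd]
    split_ifs <;> first | (exfalso; omega) | simp [pow_succ]

set_option maxHeartbeats 1000000 in
theorem jacobi1 (n : ℕ) (hn : 5 ≤ n) (hodd : Odd n) (i j k : Lab n) :
    tableMul (listed1 n) (listed1 n i j - listed1 n j i) (Pi.basisFun ℂ (Lab n) k) +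
    tableMul (listed1 n) (listed1 n j k - listed1 n k j) (Pi.basisFun ℂ (Lab n) i) +
    tableMul (listed1 n) (listed1 n k i - listed1 n i k) (Pi.basisFun ℂ (Lab n) j) = 0 := by
  refine jacobi_listedTable n (nil1 n) _ _ ?_ ?_ i j k
  · intro a b s ha hb
    unfold nil1
    split_ifs with h1 h2
    · obtain ⟨rfl, h1, h2⟩ := h1
      rw [mul_eq _ _ _ _ _ _ (by omega)]
      congr 1
      have : ¬ n = b + 1 := by omega
      fin_cases s <;> simp [wtQ, wtX, wtY, show ¬ b = 0 by omega, show ¬ b = n by omega,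
        show ¬ b + 1 = n by omega, show ¬ b = 1 by omega]
      ring
    · obtain ⟨h1, h2, h3⟩ := h2
      rw [map_smul, LinearMap.smul_apply, mul_eq _ _ _ _ _ _ (by omega), smul_comm]
      congr 1
      fin_cases s <;> simp [wtQ, wtX, wtY, show ¬ a = 1 by omega, show ¬ a = n by omega,
        show ¬ b = n by omega, show ¬ b = 1 by omega, show ¬ n = 1 by omega]
      · rw [← h3]; push_cast; ring
      · norm_num
    · simp
  · intro a b c ha hb hc
    rw [mul_nil1 n hn hodd _ _ a b c hc, mul_nil1 n hn hodd _ _ b c a ha,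
      mul_nil1 n hn hodd _ _ c a b hb]
    have key : ∀ i j : ℕ, i + 1 + j = n → (-1 : ℂ) ^ i = (-1) ^ j := by
      intro i j h
      obtain ⟨m, hm⟩ := hodd
      rcases Nat.even_or_odd i with hi | hi
      · have hj : Even j := by grind
        rw [hi.neg_one_pow, hj.neg_one_pow]
      · have hj : Odd j := by grind
        rw [hi.neg_one_pow, hj.neg_one_pow]
    have cls : ∀ k : ℕ, 1 ≤ k → k = 1 ∨ 2 ≤ k := by omega
    rcases cls a ha.1 with h | h <;> rcases cls b hb.1 with h' | h' <;>
    rcases cls c hc.1 with h'' | h'' <;>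
    simp (disch := omega) only [if_neg, add_zero, zero_add, neg_zero] <;>
    split_ifs <;> first
      | (exfalso; omega)
      | (subst_vars; simp; done)
      | (rw [key a b (by omega)]; simp)
      | (rw [key b c (by omega)]; simp)
      | (rw [key c a (by omega)]; simp)

/-- The products of `g²_{(n,1)}` on basis elements, in either order. -/
theorem nil2_sub (n a b : ℕ) (hn : 5 ≤ n) : nil2 n a b - nil2 n b a =
    if a = 1 ∧ 2 ≤ b ∧ b + 2 ≤ n then eVec n (b + 1)
    else if b = 1 ∧ 2 ≤ a ∧ a + 2 ≤ n then -eVec n (a + 1)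
    else if 2 ≤ a ∧ a + 3 ≤ n ∧ b = n then eVec n (a + 2)
    else if 2 ≤ b ∧ b + 3 ≤ n ∧ a = n then -eVec n (b + 2) else 0 := by
  unfold nil2
  split_ifs <;> first | (exfalso; omega) | simp

theorem mul_nil2_aux (n : ℕ) (hn : 5 ≤ n) (p q : ℂ) (k c : ℕ)
    (hk : 3 ≤ k ∧ k + 1 ≤ n) (hc : 1 ≤ c ∧ c ≤ n) :
    tableMul (listedTable n (nil2 n) p q) (eVec n k) (eVec n c) =
    if c = 1 ∧ k + 2 ≤ n then -eVec n (k + 1)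
    else if c = n ∧ k + 3 ≤ n then eVec n (k + 2) else 0 := by
  rw [mul_ee n (nil2 n) p q _ _ (by omega) hc, nil2_sub n _ _ hn]
  split_ifs <;> first | (exfalso; omega) | rfl

theorem mul_nil2 (n : ℕ) (hn : 5 ≤ n) (p q : ℂ) (a b c : ℕ)
    (hc : 1 ≤ c ∧ c ≤ n) :
    tableMul (listedTable n (nil2 n) p q) (nil2 n a b - nil2 n b a) (eVec n c) =
    if a = 1 ∧ 2 ≤ b ∧ b + 2 ≤ n then
      (if c = 1 ∧ b + 3 ≤ n then -eVec n (b + 2)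
       else if c = n ∧ b + 4 ≤ n then eVec n (b + 3) else 0)
    else if b = 1 ∧ 2 ≤ a ∧ a + 2 ≤ n then
      -(if c = 1 ∧ a + 3 ≤ n then -eVec n (a + 2)
       else if c = n ∧ a + 4 ≤ n then eVec n (a + 3) else 0)
    else if 2 ≤ a ∧ a + 3 ≤ n ∧ b = n then
      (if c = 1 ∧ a + 4 ≤ n then -eVec n (a + 3)
       else if c = n ∧ a + 5 ≤ n then eVec n (a + 4) else 0)
    else if 2 ≤ b ∧ b + 3 ≤ n ∧ a = n then
      -(if c = 1 ∧ b + 4 ≤ n then -eVec n (b + 3)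
       else if c = n ∧ b + 5 ≤ n then eVec n (b + 4) else 0)
    else 0 := by
  rw [nil2_sub n a b hn]
  by_cases h1 : a = 1 ∧ 2 ≤ b ∧ b + 2 ≤ n
  · rw [if_pos h1, if_pos h1, mul_nil2_aux n hn p q _ _ (by omega) hc]
  rw [if_neg h1, if_neg h1]
  by_cases h2 : b = 1 ∧ 2 ≤ a ∧ a + 2 ≤ n
  · rw [if_pos h2, if_pos h2, map_neg, LinearMap.neg_apply,
      mul_nil2_aux n hn p q _ _ (by omega) hc]
  rw [if_neg h2, if_neg h2]
  by_cases h3 : 2 ≤ a ∧ a + 3 ≤ n ∧ b = n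
  · rw [if_pos h3, if_pos h3, mul_nil2_aux n hn p q _ _ (by omega) hc]
  rw [if_neg h3, if_neg h3]
  by_cases h4 : 2 ≤ b ∧ b + 3 ≤ n ∧ a = n
  · rw [if_pos h4, if_pos h4, map_neg, LinearMap.neg_apply,
      mul_nil2_aux n hn p q _ _ (by omega) hc]
  rw [if_neg h4, if_neg h4, map_zero, LinearMap.zero_apply]

set_option maxHeartbeats 1000000 in
theorem jacobi2 (n : ℕ) (hn : 5 ≤ n) (i j k : Lab n) :
    tableMul (listed2 n) (listed2 n i j - listed2 n j i) (Pi.basisFun ℂ (Lab n) k) +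
    tableMul (listed2 n) (listed2 n j k - listed2 n k j) (Pi.basisFun ℂ (Lab n) i) +
    tableMul (listed2 n) (listed2 n k i - listed2 n i k) (Pi.basisFun ℂ (Lab n) j) = 0 := by
  refine jacobi_listedTable n (nil2 n) _ _ ?_ ?_ i j k
  · intro a b s ha hb
    unfold nil2
    split_ifs with h1 h2
    · obtain ⟨rfl, h1, h2⟩ := h1
      rw [mul_eq _ _ _ _ _ _ (by omega)]
      congr 1
      fin_cases s <;> simp [wtQ, wtX, wtY, show ¬ b = 0 by omega, show ¬ b = n by omega,
        show ¬ b + 1 = n by omega, show ¬ b = 1 by omega]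
      ring
    · obtain ⟨h1, h2, rfl⟩ := h2
      rw [mul_eq _ _ _ _ _ _ (by omega)]
      congr 1
      fin_cases s <;> simp [wtQ, wtX, wtY, show ¬ a = 1 by omega, show ¬ a = b by omega,
        show ¬ a + 2 = b by omega, show ¬ b = 1 by omega]
    · simp
  · intro a b c ha hb hc
    rw [mul_nil2 n hn _ _ a b c hc, mul_nil2 n hn _ _ b c a ha, mul_nil2 n hn _ _ c a b hb]
    have cls : ∀ k : ℕ, (1 ≤ k ∧ k ≤ n) → k = 1 ∨ k = n ∨ (2 ≤ k ∧ k + 1 ≤ n) := by omega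
    rcases cls a ha with h | h | h <;> rcases cls b hb with h' | h' | h' <;>
    rcases cls c hc with h'' | h'' | h'' <;>
    simp (disch := omega) only [if_neg, add_zero, zero_add, neg_zero] <;>
    split_ifs <;> first
      | (exfalso; omega)
      | (subst_vars; simp)

/-- The complex Lie algebra `R(g¹_{(n,1)}, 2)`. -/
def R1 (n : ℕ) (hn : 5 ≤ n) (hodd : Odd n) : LieTable (Lab n) where
  listed := listed1 n
  jacobi := jacobi1 n hn hodd

/-- The complex Lie algebra `R(g²_{(n,1)}, 2)`. -/
def R2 (n : ℕ) (hn : 5 ≤ n) : LieTable (Lab n) where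
  listed := listed2 n
  jacobi := jacobi2 n hn

end

/-!
The torus spanned by `x` and `y` acts diagonally, and Cartan's formula shows that every cocycle is
cohomologous to one that preserves weights. For such a cocycle `φ`, the contractions `φ(x, ·)` and
`φ(y, ·)` are derivations commuting with the torus; they turn out to be inner, by elements of the
torus. The weights of the nilradical are pairwise distinct, and `[e_a, e_b] ≠ 0` whenever the sum of
the weights of `e_a` and `e_b` is a weight, so that `φ(e_a, e_b) = c(a, b) [e_a, e_b]` for scalars
`c(a, b)`. The cocycle condition is a recurrence for these scalars, whose solutions have the form
`c(a, b) = μ a + μ b - μ d` when `[e_a, e_b]` is a nonzero multiple of `e_d`. Hence `φ` agrees on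
the nilradical with the coboundary of the diagonal map given by `μ`, and then everywhere once
suitable values in the torus are given to the images of `x` and `y`.
-/

open LieModule.Cohomology

section Cohomology

variable {K L M : Type*} [CommRing K] [LieRing L] [LieAlgebra K L]
  [AddCommGroup M] [Module K M]

theorem twoCochain_sub_apply_apply (φ ψ : twoCochain K L M) (u v : L) :
    (φ - ψ) u v = φ u v - ψ u v :=
  rfl

variable [LieRingModule L M] [LieModule K L M]

theorem d₁₂_mem_twoCocycle (f : L →ₗ[K] M) : d₁₂ K L M f ∈ twoCocycle K L M := by
  rw [mem_twoCocycle_iff, ← LinearMap.comp_apply, d₂₃_comp_d₁₂, LinearMap.zero_apply]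

theorem twoCocycle_apply {φ : twoCochain K L M} (hφ : φ ∈ twoCocycle K L M) (u v w : L) :
    ⁅u, φ v w⁆ - ⁅v, φ u w⁆ + ⁅w, φ u v⁆ - φ ⁅u, v⁆ w + φ ⁅u, w⁆ v - φ ⁅v, w⁆ u = 0 := by
  rw [mem_twoCocycle_iff] at hφ
  simpa only [d₂₃_apply, LinearMap.zero_apply] using congrArg (fun ψ => ψ u v w) hφ

theorem d₁₂_lie_apply_apply (h : L) (f : L →ₗ[K] M) (u v : L) :
    d₁₂ K L M ⁅h, f⁆ u v =
      ⁅h, d₁₂ K L M f u v⁆ - d₁₂ K L M f ⁅h, u⁆ v - d₁₂ K L M f u ⁅h, v⁆ := by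
  simp only [d₁₂_apply_apply, LieHom.lie_apply, lie_sub]
  rw [leibniz_lie h u v, leibniz_lie h u (f v), leibniz_lie h v (f u), map_add]
  abel

/- Cartan's formula `d (ι_h φ) = h · φ - ι_h (d φ)`, where the last term vanishes. -/
theorem d₁₂_apply_of_mem_twoCocycle {φ : twoCochain K L M} (hφ : φ ∈ twoCocycle K L M)
    (h u v : L) :
    d₁₂ K L M (φ h) u v = ⁅h, φ u v⁆ - φ ⁅h, u⁆ v - φ u ⁅h, v⁆ := by
  have hcocycle := twoCocycle_apply hφ h u v
  rw [← twoCochain_skew φ u ⁅h, v⁆, ← twoCochain_skew φ h ⁅u, v⁆] at hcocycle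
  rw [d₁₂_apply_apply, ← sub_eq_zero, ← neg_eq_zero, ← hcocycle]
  abel

theorem d₁₂_apply_of_smul (f : L →ₗ[K] L) {u v : L} {a b c : K}
    (hu : f u = a • u) (hv : f v = b • v) (huv : f ⁅u, v⁆ = c • ⁅u, v⁆) :
    d₁₂ K L L f u v = (a + b - c) • ⁅u, v⁆ := by
  rw [d₁₂_apply_apply, hu, hv, huv, lie_smul, lie_smul, ← lie_skew u v]
  module

/- For `⁅u, w⁆ = 0` the Jacobi identity reads `⁅⁅u, v⁆, w⁆ = ⁅u, ⁅v, w⁆⁆`, and the cocycle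
condition compares the two sides. -/
theorem smul_lie_lie_eq_of_mem_twoCocycle {φ : twoCochain K L L} (hφ : φ ∈ twoCocycle K L L)
    {u v w : L} {p q r s : K} (huw : ⁅u, w⁆ = 0) (hφuw : φ u w = 0)
    (huv : φ u v = p • ⁅u, v⁆) (hvw : φ v w = q • ⁅v, w⁆)
    (huv_w : φ ⁅u, v⁆ w = r • ⁅⁅u, v⁆, w⁆) (hu_vw : φ u ⁅v, w⁆ = s • ⁅u, ⁅v, w⁆⁆) :
    (p + r) • ⁅⁅u, v⁆, w⁆ = (q + s) • ⁅⁅u, v⁆, w⁆ := by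
  have hassoc : ⁅u, ⁅v, w⁆⁆ = ⁅⁅u, v⁆, w⁆ := by rw [leibniz_lie, huw, lie_zero, add_zero]
  have hcocycle := twoCocycle_apply hφ u v w
  rw [← twoCochain_skew φ u ⁅v, w⁆, hφuw, huv, hvw, huv_w, hu_vw, huw, lie_smul, lie_smul,
    ← lie_skew w, hassoc, lie_zero, map_zero, LinearMap.zero_apply] at hcocycle
  rw [← sub_eq_zero, ← neg_eq_zero, ← hcocycle]
  module

theorem apply_mem_span_lie_of_forall_lt {ι : Type*} [LinearOrder ι] {φ : twoCochain K L L}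
    {e : ι → L} (h : ∀ i j, i < j → φ (e i) (e j) ∈ K ∙ ⁅e i, e j⁆) (i j : ι) :
    φ (e i) (e j) ∈ K ∙ ⁅e i, e j⁆ := by
  rcases lt_trichotomy i j with hij | rfl | hji
  · exact h i j hij
  · rw [twoCochain_alt]
    exact zero_mem _
  · obtain ⟨c, hc⟩ := Submodule.mem_span_singleton.1 (h j i hji)
    exact Submodule.mem_span_singleton.2
      ⟨c, by rw [← twoCochain_skew, ← hc, ← lie_skew, smul_neg]⟩

end Cohomology

theorem subsingleton_adjointH2_of_forall_eq_d₁₂ {K L : Type} [CommRing K] [LieRing L]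
    [LieAlgebra K L] (h : ∀ φ ∈ twoCocycle K L L, ∃ f : L →ₗ[K] L, φ = d₁₂ K L L f) :
    Subsingleton (AdjointH2 K L) := by
  rw [Submodule.Quotient.subsingleton_iff, eq_top_iff]
  rintro ⟨φ, hφ⟩ -
  obtain ⟨f, rfl⟩ := h φ hφ
  exact ⟨f, rfl⟩

section Weights

/-- The span of the basis vectors of weight `m`, where `w i` is the weight of `b i`. -/
def weightSpan {ι Λ K V : Type*} [Semiring K] [AddCommMonoid V] [Module K V] (b : Basis ι K V)
    (w : ι → Λ) (m : Λ) : Submodule K V :=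
  Submodule.span K (b '' (w ⁻¹' {m}))

/-- A 2-cochain is homogeneous of degree zero for the grading given by the weights `w` of `b`. -/
def PreservesWeights {ι Λ K L : Type*} [Add Λ] [CommRing K] [LieRing L] [LieAlgebra K L]
    (b : Basis ι K L) (w : ι → Λ) (φ : twoCochain K L L) : Prop :=
  ∀ i j, φ (b i) (b j) ∈ weightSpan b w (w i + w j)

/-- The weights of all basis vectors, including the weight zero of the torus. -/
def fullWeight {ι κ K : Type*} [Zero K] (χ : ι → κ → K) : ι ⊕ κ → κ → K :=
  Sum.elim χ 0

variable {ι Λ K V : Type*}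

theorem mem_weightSpan_iff [Semiring K] [AddCommMonoid V] [Module K V] {b : Basis ι K V}
    {w : ι → Λ} {m : Λ} {v : V} : v ∈ weightSpan b w m ↔ ∀ k, b.repr v k ≠ 0 → w k = m := by
  simp [weightSpan, Basis.mem_span_image, Set.subset_def]

theorem repr_apply_of_forall_smul [CommSemiring K] [AddCommMonoid V] [Module K V] (b : Basis ι K V)
    {D : V →ₗ[K] V} {c : ι → K} (hD : ∀ i, D (b i) = c i • b i) (v : V) (k : ι) :
    b.repr (D v) k = c k * b.repr v k := by
  have hcoord : b.coord k ∘ₗ D = c k • b.coord k := by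
    refine b.ext fun i => ?_
    obtain rfl | hik := eq_or_ne i k
    · simp [hD]
    · simp [hD, hik]
  exact LinearMap.congr_fun hcoord v

theorem weightSpan_weight {κ : Type*} [Semiring K] [AddCommMonoid V] [Module K V]
    (b : Basis (ι ⊕ κ) K V) {χ : ι → κ → K} (hinj : Function.Injective χ) (hne : ∀ i, χ i ≠ 0)
    (i : ι) :
    weightSpan b (fullWeight χ) (χ i) = K ∙ b (.inl i) := by
  have : fullWeight χ ⁻¹' {χ i} = {.inl i} := by
    ext (j | s)
    · simp [fullWeight, hinj.eq_iff]
    · simp [fullWeight, (hne i).symm]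
  rw [weightSpan, this, Set.image_singleton]

end Weights

section DiagonalElement

variable {ι K L : Type*} [Field K] [LieRing L] [LieAlgebra K L]
  {b : Basis ι K L} {h : L} {c : ι → K}

theorem repr_lie_of_forall_lie_eq_smul (hb : ∀ i, ⁅h, b i⁆ = c i • b i) (v : L) (k : ι) :
    b.repr ⁅h, v⁆ k = c k * b.repr v k :=
  repr_apply_of_forall_smul b (D := LieAlgebra.ad K L h) hb v k

theorem repr_lie_apply_of_forall_lie_eq_smul (hb : ∀ i, ⁅h, b i⁆ = c i • b i) (g : L →ₗ[K] L)
    (i k : ι) : b.repr (⁅h, g⁆ (b i)) k = (c k - c i) * b.repr (g (b i)) k := by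
  rw [LieHom.lie_apply, hb, map_smul, map_sub, map_smul, Finsupp.sub_apply, Finsupp.smul_apply,
    repr_lie_of_forall_lie_eq_smul hb, smul_eq_mul, sub_mul]

/- `h` acts semisimply on the endomorphisms, so these are the sum of its kernel and its image. -/
theorem exists_lie_sub_lie_eq_zero (hb : ∀ i, ⁅h, b i⁆ = c i • b i) (g : L →ₗ[K] L) :
    ∃ f : L →ₗ[K] L, ⁅h, g - ⁅h, f⁆⁆ = 0 := by
  let D (i : ι) : L →ₗ[K] L := b.constr K fun k => (c k - c i)⁻¹ • b k
  refine ⟨b.constr K fun i => D i (g (b i)), b.ext fun i => b.ext_elem fun k => ?_⟩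
  have hD : b.repr (D i (g (b i))) k = (c k - c i)⁻¹ * b.repr (g (b i)) k :=
    repr_apply_of_forall_smul b (fun k => b.constr_basis K _ k) _ k
  rw [repr_lie_apply_of_forall_lie_eq_smul hb, LinearMap.sub_apply, map_sub, Finsupp.sub_apply,
    repr_lie_apply_of_forall_lie_eq_smul hb, b.constr_basis, hD, LinearMap.zero_apply, map_zero,
    Finsupp.zero_apply]
  obtain hki | hki := eq_or_ne (c k - c i) 0
  · rw [hki, zero_mul]
  · rw [mul_inv_cancel_left₀ hki, sub_self, mul_zero]

theorem repr_lie_sub_sub_of_forall_lie_eq_smul (hb : ∀ i, ⁅h, b i⁆ = c i • b i)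
    (φ : twoCochain K L L) (i j k : ι) :
    b.repr (⁅h, φ (b i) (b j)⁆ - φ ⁅h, b i⁆ (b j) - φ (b i) ⁅h, b j⁆) k =
      (c k - (c i + c j)) * b.repr (φ (b i) (b j)) k := by
  simp only [map_sub, Finsupp.sub_apply, repr_lie_of_forall_lie_eq_smul hb, hb, map_smul,
    LinearMap.smul_apply, Finsupp.smul_apply, smul_eq_mul]
  ring

/- Cartan's formula gives `h · (φ - d f) = d g` with `g = ι_h φ - h · f`, and `f` is chosen so that
`h · g = 0`. Hence `h` squared kills `φ - d f`, and so does `h`, which acts semisimply. -/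
theorem exists_preservesWeights_sub_d₁₂ (hb : ∀ i, ⁅h, b i⁆ = c i • b i)
    {φ : twoCochain K L L} (hφ : φ ∈ twoCocycle K L L) :
    ∃ f : L →ₗ[K] L, PreservesWeights b c (φ - d₁₂ K L L f) := by
  obtain ⟨f, hf⟩ := exists_lie_sub_lie_eq_zero hb (φ h)
  refine ⟨f, fun i j => mem_weightSpan_iff.2 fun k hk => ?_⟩
  let ψ := φ - d₁₂ K L L f
  set g := φ h - ⁅h, f⁆ with hg
  have hψ : b.repr (d₁₂ K L L g (b i) (b j)) k =
      (c k - (c i + c j)) * b.repr (ψ (b i) (b j)) k := by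
    rw [← repr_lie_sub_sub_of_forall_lie_eq_smul hb, hg, map_sub, twoCochain_sub_apply_apply,
      d₁₂_apply_of_mem_twoCocycle hφ, d₁₂_lie_apply_apply]
    simp only [ψ, twoCochain_sub_apply_apply, lie_sub]
    congr 2
    abel
  have hdg : (c k - (c i + c j)) * b.repr (d₁₂ K L L g (b i) (b j)) k = 0 := by
    rw [← repr_lie_sub_sub_of_forall_lie_eq_smul hb, ← d₁₂_lie_apply_apply, hf, map_zero]
    change b.repr (0 : L) k = 0
    rw [map_zero, Finsupp.zero_apply]
  rw [hψ, ← mul_assoc] at hdg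
  exact sub_eq_zero.1 (mul_self_eq_zero.1 ((mul_eq_zero.1 hdg).resolve_right hk))

end DiagonalElement

section WeightBasis

variable {ι κ K L : Type*} [Field K] [LieRing L] [LieAlgebra K L]

/-- A basis of `L` adapted to a torus acting diagonally: the `b (.inr s)` commute and span the
torus, and `χ i` is the weight of `b (.inl i)`. As in the tables of solvable Lie algebras, the torus
acts from the right. -/
structure IsWeightBasis (b : Basis (ι ⊕ κ) K L) (χ : ι → κ → K) : Prop where
  lie_inl_inr : ∀ i s, ⁅b (.inl i), b (.inr s)⁆ = χ i s • b (.inl i)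
  lie_inr_inr : ∀ s t, ⁅b (.inr s), b (.inr t)⁆ = 0

theorem twoCochain_ext_of_lt [LinearOrder ι] (b : Basis (ι ⊕ κ) K L) {φ ψ : twoCochain K L L}
    (hll : ∀ i j, i < j → φ (b (.inl i)) (b (.inl j)) = ψ (b (.inl i)) (b (.inl j)))
    (hlr : ∀ i s, φ (b (.inl i)) (b (.inr s)) = ψ (b (.inl i)) (b (.inr s)))
    (hrr : ∀ s t, φ (b (.inr s)) (b (.inr t)) = ψ (b (.inr s)) (b (.inr t))) : φ = ψ := by
  refine Subtype.ext <| b.ext fun k => b.ext fun l => ?_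
  change φ (b k) (b l) = ψ (b k) (b l)
  rcases k with i | s <;> rcases l with j | t
  · rcases lt_trichotomy i j with hij | rfl | hji
    · exact hll i j hij
    · rw [twoCochain_alt, twoCochain_alt]
    · rw [← twoCochain_skew, hll j i hji, twoCochain_skew]
  · exact hlr i t
  · rw [← twoCochain_skew, hlr j s, twoCochain_skew]
  · exact hrr s t

namespace IsWeightBasis

variable {b : Basis (ι ⊕ κ) K L} {χ : ι → κ → K}

theorem inr_lie (hb : IsWeightBasis b χ) (s : κ) (k : ι ⊕ κ) :
    ⁅b (.inr s), b k⁆ = -(fullWeight χ k s) • b k := by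
  rw [← lie_skew]
  rcases k with i | t
  · rw [hb.lie_inl_inr, neg_smul]; rfl
  · rw [hb.lie_inr_inr]; simp [fullWeight]

theorem lie_mem_weightSpan (hb : IsWeightBasis b χ) (i j : ι ⊕ κ) :
    ⁅b i, b j⁆ ∈ weightSpan b (fullWeight χ) (fullWeight χ i + fullWeight χ j) := by
  refine mem_weightSpan_iff.2 fun k hk => funext fun s => ?_
  have hs := congrArg (b.repr · k) (leibniz_lie (b (.inr s)) (b i) (b j))
  simp only [repr_lie_of_forall_lie_eq_smul (hb.inr_lie s), hb.inr_lie, smul_lie, lie_smul, map_add,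
    map_smul, Finsupp.add_apply, Finsupp.smul_apply, smul_eq_mul, ← add_mul] at hs
  have := mul_right_cancel₀ hk hs
  rw [Pi.add_apply]
  linear_combination -this

theorem d₁₂_apply_inr_eq_zero (hb : IsWeightBasis b χ) {φ : twoCochain K L L}
    (hφ : φ ∈ twoCocycle K L L) (hφw : PreservesWeights b (fullWeight χ) φ) (s : κ) :
    d₁₂ K L L (φ (b (.inr s))) = 0 := by
  refine Subtype.ext <| b.ext fun i => b.ext fun j => b.ext_elem fun k => ?_
  change b.repr (d₁₂ K L L (φ (b (.inr s))) (b i) (b j)) k = b.repr (0 : L) k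
  rw [d₁₂_apply_of_mem_twoCocycle hφ, repr_lie_sub_sub_of_forall_lie_eq_smul (hb.inr_lie s),
    map_zero, Finsupp.zero_apply, mul_eq_zero, or_iff_not_imp_right]
  intro hk
  rw [mem_weightSpan_iff.1 (hφw i j) k hk, Pi.add_apply]
  ring

theorem apply_inl_inl_mem_span (hb : IsWeightBasis b χ)
    (hinj : Function.Injective χ) (hne : ∀ i, χ i ≠ 0) {i j : ι} (hadd : χ i + χ j ≠ 0)
    (hsat : ∀ m, χ m = χ i + χ j → ⁅b (.inl i), b (.inl j)⁆ ≠ 0) {φ : twoCochain K L L}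
    (hφw : PreservesWeights b (fullWeight χ) φ) :
    φ (b (.inl i)) (b (.inl j)) ∈ K ∙ ⁅b (.inl i), b (.inl j)⁆ := by
  have hφij : φ (b (.inl i)) (b (.inl j)) ∈ weightSpan b (fullWeight χ) (χ i + χ j) :=
    hφw (.inl i) (.inl j)
  by_cases hm : ∃ m, χ m = χ i + χ j
  · obtain ⟨m, hm⟩ := hm
    have hij : ⁅b (.inl i), b (.inl j)⁆ ∈ weightSpan b (fullWeight χ) (χ i + χ j) :=
      hb.lie_mem_weightSpan (.inl i) (.inl j)
    rw [← hm, weightSpan_weight b hinj hne, Submodule.mem_span_singleton] at hφij hij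
    obtain ⟨r, hr⟩ := hφij
    obtain ⟨q, hq⟩ := hij
    have hq_ne : q ≠ 0 := by
      rintro rfl
      exact hsat m hm (by rw [← hq, zero_smul])
    rw [← hr, ← hq]
    exact Submodule.mem_span_singleton.2 ⟨r * q⁻¹, by rw [smul_smul, inv_mul_cancel_right₀ hq_ne]⟩
  · have hempty : fullWeight χ ⁻¹' {χ i + χ j} = ∅ := by
      ext (m | s)
      · simpa [fullWeight] using not_exists.1 hm m
      · simpa [fullWeight] using hadd.symm
    rw [weightSpan, hempty, Set.image_empty, Submodule.span_empty, Submodule.mem_bot] at hφij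
    rw [hφij]
    exact zero_mem _

end IsWeightBasis

variable [Fintype κ]

/-- The element of the torus with coordinates `t`. -/
noncomputable def torusElement (b : Basis (ι ⊕ κ) K L) (t : κ → K) : L :=
  ∑ s, t s • b (.inr s)

/-- The linear map that multiplies `b (.inl i)` by `μ i` and sends the torus element `b (.inr s)`
to the torus element with coordinates `t s`. -/
noncomputable def weightDiagonal (b : Basis (ι ⊕ κ) K L) (μ : ι → K) (t : κ → κ → K) : L →ₗ[K] L :=
  b.constr K (Sum.elim (fun i => μ i • b (.inl i)) fun s => torusElement b (t s))

theorem weightDiagonal_inl (b : Basis (ι ⊕ κ) K L) (μ : ι → K) (t : κ → κ → K) (i : ι) :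
    weightDiagonal b μ t (b (.inl i)) = μ i • b (.inl i) :=
  b.constr_basis K _ _

theorem weightDiagonal_inr (b : Basis (ι ⊕ κ) K L) (μ : ι → K) (t : κ → κ → K) (s : κ) :
    weightDiagonal b μ t (b (.inr s)) = torusElement b (t s) :=
  b.constr_basis K _ _

variable {b : Basis (ι ⊕ κ) K L} {χ : ι → κ → K}

namespace IsWeightBasis

theorem lie_inl_torusElement (hb : IsWeightBasis b χ) (i : ι) (t : κ → K) :
    ⁅b (.inl i), torusElement b t⁆ = (χ i ⬝ᵥ t) • b (.inl i) := by
  simp only [torusElement, lie_sum, lie_smul, hb.lie_inl_inr, smul_smul, ← Finset.sum_smul,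
    dotProduct, mul_comm]

theorem lie_inr_torusElement (hb : IsWeightBasis b χ) (s : κ) (t : κ → K) :
    ⁅b (.inr s), torusElement b t⁆ = 0 := by
  simp only [torusElement, lie_sum, lie_smul, hb.lie_inr_inr, smul_zero, Finset.sum_const_zero]

theorem torusElement_lie (hb : IsWeightBasis b χ) (t : κ → K) (k : ι ⊕ κ) :
    ⁅torusElement b t, b k⁆ = -(fullWeight χ k ⬝ᵥ t) • b k := by
  rw [← lie_skew]
  rcases k with i | s
  · rw [hb.lie_inl_torusElement, neg_smul]; rfl
  · rw [hb.lie_inr_torusElement]; simp [fullWeight]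

end IsWeightBasis

theorem exists_torusElement_eq (hne : ∀ i, χ i ≠ 0) {v : L}
    (hv : v ∈ weightSpan b (fullWeight χ) 0) : ∃ t, torusElement b t = v := by
  have : fullWeight χ ⁻¹' {0} = Set.range .inr := by
    ext (i | s)
    · simp [fullWeight, hne i]
    · simp [fullWeight]
  rwa [weightSpan, this, ← Set.range_comp, Submodule.mem_span_range_iff_exists_fun] at hv

theorem weightDiagonal_apply_of_mem_weightSpan {m : κ → K} (hm : m ≠ 0) {v : L}
    (hv : v ∈ weightSpan b (fullWeight χ) m) (μ : ι → K) (t t' : κ → κ → K) :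
    weightDiagonal b μ t v = weightDiagonal b μ t' v := by
  refine LinearMap.eqOn_span ?_ hv
  rintro _ ⟨i | s, hk, rfl⟩
  · rw [weightDiagonal_inl, weightDiagonal_inl]
  · exact absurd hk hm.symm

namespace IsWeightBasis

theorem exists_preservesWeights_sub_d₁₂ {κ : Type*} [Finite ι] [Finite κ] [Infinite K]
    {b : Basis (ι ⊕ κ) K L} {χ : ι → κ → K} (hb : IsWeightBasis b χ)
    {φ : twoCochain K L L} (hφ : φ ∈ twoCocycle K L L) :
    ∃ f : L →ₗ[K] L, PreservesWeights b (fullWeight χ) (φ - d₁₂ K L L f) := by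
  classical
  cases nonempty_fintype κ
  let w := fullWeight χ
  let v (x : {x : (ι ⊕ κ) × (ι ⊕ κ) × (ι ⊕ κ) // w x.1 - (w x.2.1 + w x.2.2) ≠ 0}) : κ → K :=
    w x.1.1 - (w x.1.2.1 + w x.1.2.2)
  obtain ⟨ℓ, hℓ⟩ := exists_dual_forall_apply_ne_zero (K := K) v Subtype.prop
  obtain ⟨t, rfl⟩ := (dotProductEquiv K κ).surjective ℓ
  obtain ⟨f, hf⟩ := _root_.exists_preservesWeights_sub_d₁₂ (hb.torusElement_lie t) hφ
  refine ⟨f, fun i j => mem_weightSpan_iff.2 fun k hk => ?_⟩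
  by_contra hne
  refine hℓ ⟨(k, i, j), sub_ne_zero.2 hne⟩ ?_
  have := mem_weightSpan_iff.1 (hf i j) k hk
  simp only [v, w, dotProductEquiv_apply_apply, dotProduct_comm t, sub_dotProduct,
    add_dotProduct]
  linear_combination -this

theorem exists_apply_inr_eq_weightDiagonal (hb : IsWeightBasis b χ)
    (hinj : Function.Injective χ) (hne : ∀ i, χ i ≠ 0)
    (hfaithful : ∀ t, (∀ i, χ i ⬝ᵥ t = 0) → t = 0) {φ : twoCochain K L L}
    (hφ : φ ∈ twoCocycle K L L) (hφw : PreservesWeights b (fullWeight χ) φ) (s : κ) :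
    ∃ μ : ι → K, φ (b (.inr s)) = weightDiagonal b μ 0 := by
  have hmem (k : ι ⊕ κ) : φ (b (.inr s)) (b k) ∈ weightSpan b (fullWeight χ) (fullWeight χ k) := by
    simpa [fullWeight] using hφw (.inr s) k
  have hinl (i : ι) : ∃ μ : K, φ (b (.inr s)) (b (.inl i)) = μ • b (.inl i) := by
    have hi : φ (b (.inr s)) (b (.inl i)) ∈ K ∙ b (.inl i) := by
      rw [← weightSpan_weight b hinj hne]
      exact hmem (.inl i)
    obtain ⟨μ, hμ⟩ := Submodule.mem_span_singleton.1 hi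
    exact ⟨μ, hμ.symm⟩
  choose μ hμ using hinl
  refine ⟨μ, b.ext ?_⟩
  rintro (i | t)
  · rw [hμ, weightDiagonal_inl]
  obtain ⟨τ, hτ⟩ := exists_torusElement_eq hne (hmem (.inr t))
  suffices hτ_zero : τ = 0 by
    rw [weightDiagonal_inr, ← hτ, hτ_zero]; rfl
  refine hfaithful τ fun i => ?_
  have hder : d₁₂ K L L (φ (b (.inr s))) (b (.inl i)) (b (.inr t)) = 0 := by
    rw [hb.d₁₂_apply_inr_eq_zero hφ hφw]; rfl
  rw [d₁₂_apply_apply, ← hτ, hμ, hb.lie_inl_torusElement, ← lie_skew, smul_lie, hb.lie_inl_inr,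
    map_smul, hμ, smul_comm, sub_neg_eq_add, add_sub_cancel_right] at hder
  exact (smul_eq_zero.1 hder).resolve_right (b.ne_zero _)

theorem d₁₂_weightDiagonal_inl_inl (hb : IsWeightBasis b χ) {i j : ι} (hadd : χ i + χ j ≠ 0)
    (μ : ι → K) (t t' : κ → κ → K) :
    d₁₂ K L L (weightDiagonal b μ t) (b (.inl i)) (b (.inl j)) =
      d₁₂ K L L (weightDiagonal b μ t') (b (.inl i)) (b (.inl j)) := by
  simp only [d₁₂_apply_apply, weightDiagonal_inl, weightDiagonal_apply_of_mem_weightSpan hadd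
    (hb.lie_mem_weightSpan (.inl i) (.inl j)) μ t t']

end IsWeightBasis

theorem IsWeightBasis.exists_eq_d₁₂_weightDiagonal [LinearOrder ι] (hb : IsWeightBasis b χ)
    (hinj : Function.Injective χ) (hne : ∀ i, χ i ≠ 0) (hadd : ∀ i j, i < j → χ i + χ j ≠ 0)
    (hfaithful : ∀ t, (∀ i, χ i ⬝ᵥ t = 0) → t = 0)
    (hinner : ∀ μ : ι → K, d₁₂ K L L (weightDiagonal b μ 0) = 0 → ∃ t, ∀ i, μ i = χ i ⬝ᵥ t)
    {φ : twoCochain K L L} (hφ : φ ∈ twoCocycle K L L)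
    (hφw : PreservesWeights b (fullWeight χ) φ)
    {ν : ι → K} (hν : ∀ i j, i < j → φ (b (.inl i)) (b (.inl j)) =
      d₁₂ K L L (weightDiagonal b ν 0) (b (.inl i)) (b (.inl j))) :
    ∃ t, φ = d₁₂ K L L (weightDiagonal b ν t) := by
  choose μ hμ using hb.exists_apply_inr_eq_weightDiagonal hinj hne hfaithful hφ hφw
  have hder (s : κ) : d₁₂ K L L (weightDiagonal b (μ s) 0) = 0 := by
    rw [← hμ, hb.d₁₂_apply_inr_eq_zero hφ hφw]
  choose t ht using fun s => hinner (μ s) (hder s)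
  refine ⟨-t, twoCochain_ext_of_lt b (fun i j hij => ?_) (fun i s => ?_) fun s s' => ?_⟩
  · rw [hν i j hij, hb.d₁₂_weightDiagonal_inl_inl (hadd i j hij)]
  · rw [← twoCochain_skew, hμ, weightDiagonal_inl, d₁₂_apply_apply, weightDiagonal_inl,
      weightDiagonal_inr, hb.lie_inl_torusElement, hb.lie_inl_inr, map_smul, weightDiagonal_inl,
      lie_smul, ← lie_skew, hb.lie_inl_inr, Pi.neg_apply, dotProduct_neg, ← ht]
    module
  · rw [hμ, d₁₂_apply_apply, weightDiagonal_inr, weightDiagonal_inr, weightDiagonal_inr,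
      hb.lie_inr_torusElement, hb.lie_inr_torusElement, hb.lie_inr_inr, map_zero]
    simp [torusElement]

/- The torus makes every cocycle homogeneous of degree zero. It is then determined by derivations
commuting with the torus and by the factors by which it rescales the brackets of weight vectors. -/
theorem IsWeightBasis.subsingleton_adjointH2 {K L : Type} [Field K] [Infinite K] [LieRing L]
    [LieAlgebra K L] [LinearOrder ι] [Finite ι] {b : Basis (ι ⊕ κ) K L} {χ : ι → κ → K}
    (hb : IsWeightBasis b χ)
    (hinj : Function.Injective χ) (hne : ∀ i, χ i ≠ 0) (hadd : ∀ i j, i < j → χ i + χ j ≠ 0)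
    (hfaithful : ∀ t, (∀ i, χ i ⬝ᵥ t = 0) → t = 0)
    (hsat : ∀ i j m, i < j → χ m = χ i + χ j → ⁅b (.inl i), b (.inl j)⁆ ≠ 0)
    (hinner : ∀ μ : ι → K, d₁₂ K L L (weightDiagonal b μ 0) = 0 → ∃ t, ∀ i, μ i = χ i ⬝ᵥ t)
    (hcob : ∀ φ ∈ twoCocycle K L L,
      (∀ i j, i < j → φ (b (.inl i)) (b (.inl j)) ∈ K ∙ ⁅b (.inl i), b (.inl j)⁆) →
      ∃ ν : ι → K, ∀ i j, i < j → φ (b (.inl i)) (b (.inl j)) =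
        d₁₂ K L L (weightDiagonal b ν 0) (b (.inl i)) (b (.inl j))) :
    Subsingleton (AdjointH2 K L) := by
  refine subsingleton_adjointH2_of_forall_eq_d₁₂ fun φ hφ => ?_
  obtain ⟨f, hf⟩ := hb.exists_preservesWeights_sub_d₁₂ hφ
  have hφf : φ - d₁₂ K L L f ∈ twoCocycle K L L := sub_mem hφ (d₁₂_mem_twoCocycle f)
  obtain ⟨ν, hν⟩ := hcob _ hφf fun i j hij =>
    hb.apply_inl_inl_mem_span hinj hne (hadd i j hij) (fun m => hsat i j m hij) hf
  obtain ⟨t, ht⟩ :=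
    hb.exists_eq_d₁₂_weightDiagonal hinj hne hadd hfaithful hinner hφf hf hν
  exact ⟨weightDiagonal b ν t + f, by rw [map_add, ← ht, sub_add_cancel]⟩

end WeightBasis

section Table

/-- The weights `![r, s]` with `[e_k, x] = r • e_k` and `[e_k, y] = s • e_k` in `listedTable`, for
integral `p` and `q`. -/
def intWeight (n : ℕ) (p q : ℤ) (k : ℕ) : Fin 2 → ℤ :=
  ![if k = 1 then 1 else if k = n then p else k - 2, if k = 1 then 0 else if k = n then q else 1]

theorem wtQ_intCast (n : ℕ) (p q : ℤ) (s : Fin 2) (k : ℕ) :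
    wtQ n p q s k = intWeight n p q k s := by
  fin_cases s
  · simp [wtQ, wtX, intWeight, apply_ite (Int.cast : ℤ → ℂ)]
  · simp [wtQ, wtY, intWeight, apply_ite (Int.cast : ℤ → ℂ)]

theorem intWeight_injOn {n : ℕ} {p q : ℤ} (hpq : 2 ≤ p + q) (hq : q ≠ 1) :
    Set.InjOn (intWeight n p q) (Set.Icc 1 n) := by
  rintro a ⟨ha, han⟩ b ⟨hb, hbn⟩ hab
  have hx := congrFun hab 0
  have hy := congrFun hab 1
  simp only [intWeight, Matrix.cons_val_zero, Matrix.cons_val_one] at hx hy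
  split_ifs at hx hy <;> omega

theorem intWeight_total_pos {n : ℕ} {p q : ℤ} (hpq : 2 ≤ p + q) {k : ℕ} (hk : 1 ≤ k) :
    0 < intWeight n p q k 0 + intWeight n p q k 1 := by
  simp only [intWeight, Matrix.cons_val_zero, Matrix.cons_val_one]
  split_ifs <;> omega

/-- The complex weights of the basis vectors `e_{i+1}` of `listedTable`. -/
def tableWeight (n : ℕ) (p q : ℤ) (i : Fin n) (s : Fin 2) : ℂ :=
  intWeight n p q (i + 1) s

theorem tableWeight_injective {n : ℕ} {p q : ℤ} (hpq : 2 ≤ p + q) (hq : q ≠ 1) :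
    Function.Injective (tableWeight n p q) := fun i j hij => by
  have hint : intWeight n p q (i + 1) = intWeight n p q (j + 1) :=
    funext fun s => Int.cast_injective (congrFun hij s)
  exact Fin.ext <| Nat.succ_injective <|
    intWeight_injOn hpq hq ⟨by omega, i.2⟩ ⟨by omega, j.2⟩ hint

theorem tableWeight_ne_zero {n : ℕ} {p q : ℤ} (hpq : 2 ≤ p + q) (i : Fin n) :
    tableWeight n p q i ≠ 0 := fun h => by
  have hint (s : Fin 2) : intWeight n p q (i + 1) s = 0 :=
    Int.cast_injective (α := ℂ) ((congrFun h s).trans Int.cast_zero.symm)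
  have hpos := intWeight_total_pos (n := n) hpq (Nat.le_add_left 1 i)
  rw [hint, hint] at hpos
  exact hpos.ne rfl

theorem tableWeight_add_ne_zero {n : ℕ} {p q : ℤ} (hpq : 2 ≤ p + q) (i j : Fin n) :
    tableWeight n p q i + tableWeight n p q j ≠ 0 := fun h => by
  have hint (s : Fin 2) : intWeight n p q (i + 1) s + intWeight n p q (j + 1) s = 0 := by
    have hs : (intWeight n p q (i + 1) s : ℂ) + intWeight n p q (j + 1) s = 0 := congrFun h s
    exact_mod_cast hs
  have hi := intWeight_total_pos (n := n) hpq (Nat.le_add_left 1 i)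
  have hj := intWeight_total_pos (n := n) hpq (Nat.le_add_left 1 j)
  linarith [hint 0, hint 1]

theorem eq_zero_of_forall_tableWeight_dotProduct {n : ℕ} (hn : 3 ≤ n) {p q : ℤ} {t : Fin 2 → ℂ}
    (ht : ∀ i, tableWeight n p q i ⬝ᵥ t = 0) : t = 0 := by
  have hx : t 0 = 0 := by
    simpa [tableWeight, intWeight, Matrix.vec2_dotProduct] using ht ⟨0, by omega⟩
  have hy : t 1 = 0 := by
    simpa [tableWeight, intWeight, Matrix.vec2_dotProduct, show 2 ≠ n by omega] using
      ht ⟨1, by omega⟩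
  ext s
  fin_cases s
  · exact hx
  · exact hy

namespace LieTable

variable {n : ℕ} (T : LieTable (Lab n))

/-- The basis vector `e_k` of the algebra (and `0` unless `1 ≤ k ≤ n`). -/
noncomputable def E (k : ℕ) : T.Alg :=
  eVec n k

theorem basis_inl (i : Fin n) : T.basis (.inl i) = T.E (i + 1) :=
  (eVec_eq n i).symm

theorem exists_basis_eq_E {k : ℕ} (hk : k ∈ Set.Icc 1 n) :
    ∃ i : Fin n, (i : ℕ) + 1 = k ∧ T.basis (.inl i) = T.E k := by
  obtain ⟨m, rfl⟩ := Nat.exists_eq_add_of_le' hk.1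
  exact ⟨⟨m, hk.2⟩, rfl, T.basis_inl _⟩

theorem E_ne_zero {k : ℕ} (hk : k ∈ Set.Icc 1 n) : T.E k ≠ 0 := by
  obtain ⟨i, -, hi⟩ := T.exists_basis_eq_E hk
  exact hi ▸ T.basis.ne_zero _

theorem E_eq_zero {k : ℕ} (hk : k ∉ Set.Icc 1 n) : T.E k = 0 := by
  funext l
  rcases l with i | s
  · exact if_neg fun hik => hk ⟨by omega, by omega⟩
  · rfl

/-- The linear map with `e_k ↦ μ k • e_k` that kills `x` and `y`. -/
noncomputable def diagonal (μ : ℕ → ℂ) : T.Alg →ₗ[ℂ] T.Alg :=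
  weightDiagonal T.basis (fun i => μ (i + 1)) 0

theorem diagonal_E (μ : ℕ → ℂ) (k : ℕ) : T.diagonal μ (T.E k) = μ k • T.E k := by
  by_cases hk : k ∈ Set.Icc 1 n
  · obtain ⟨i, rfl, hi⟩ := T.exists_basis_eq_E hk
    rw [← hi]
    exact weightDiagonal_inl _ _ _ i
  · rw [T.E_eq_zero hk, map_zero, smul_zero]

variable {T}

theorem d₁₂_diagonal_E {μ : ℕ → ℂ} {a b d : ℕ} {r : ℂ} (hab : ⁅T.E a, T.E b⁆ = r • T.E d) :
    d₁₂ ℂ T.Alg T.Alg (T.diagonal μ) (T.E a) (T.E b) = (μ a + μ b - μ d) • ⁅T.E a, T.E b⁆ :=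
  d₁₂_apply_of_smul _ (T.diagonal_E μ a) (T.diagonal_E μ b)
    (by rw [hab, map_smul, diagonal_E, smul_comm])

theorem add_eq_of_d₁₂_diagonal_eq_zero {μ : ℕ → ℂ} (hμ : d₁₂ ℂ T.Alg T.Alg (T.diagonal μ) = 0)
    {a b d : ℕ} {r : ℂ} (hab : ⁅T.E a, T.E b⁆ = r • T.E d) (hr : r ≠ 0) (hd : d ∈ Set.Icc 1 n) :
    μ a + μ b = μ d := by
  have hzero : (μ a + μ b - μ d) • r • T.E d = 0 := by
    rw [← hab, ← d₁₂_diagonal_E hab, hμ]; rfl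
  exact sub_eq_zero.1 <|
    (smul_eq_zero.1 hzero).resolve_right (smul_ne_zero hr (T.E_ne_zero hd))

theorem eq_of_d₁₂_diagonal_eq_zero (hchain : ∀ i, 2 ≤ i → i + 2 ≤ n → ⁅T.E 1, T.E i⁆ = T.E (i + 1))
    {μ : ℕ → ℂ} (hμ : d₁₂ ℂ T.Alg T.Alg (T.diagonal μ) = 0) {k : ℕ} (hk : 2 ≤ k) (hkn : k + 1 ≤ n) :
    μ k = (k - 2) * μ 1 + μ 2 := by
  induction k, hk using Nat.le_induction with
  | base => simp
  | succ k hk ih =>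
    rw [← add_eq_of_d₁₂_diagonal_eq_zero hμ ((hchain k hk hkn).trans (one_smul ℂ _).symm)
      one_ne_zero ⟨by omega, by omega⟩, ih (by omega)]
    push_cast
    ring

theorem rescaling_comm {φ : twoCochain ℂ T.Alg T.Alg} {c : ℕ → ℕ → ℂ}
    (hc : ∀ a b, φ (T.E a) (T.E b) = c a b • ⁅T.E a, T.E b⁆) {a b : ℕ}
    (hab : ⁅T.E a, T.E b⁆ ≠ 0) : c a b = c b a := by
  refine smul_left_injective ℂ hab ?_
  change c a b • ⁅T.E a, T.E b⁆ = c b a • ⁅T.E a, T.E b⁆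
  rw [← hc, ← twoCochain_skew, hc, ← smul_neg, lie_skew]

theorem exists_apply_E_eq_smul_lie {φ : twoCochain ℂ T.Alg T.Alg}
    (h : ∀ i j : Fin n, i < j →
      φ (T.basis (.inl i)) (T.basis (.inl j)) ∈ ℂ ∙ ⁅T.basis (.inl i), T.basis (.inl j)⁆) :
    ∃ c : ℕ → ℕ → ℂ, ∀ a b, φ (T.E a) (T.E b) = c a b • ⁅T.E a, T.E b⁆ := by
  have hmem (a b : ℕ) : φ (T.E a) (T.E b) ∈ ℂ ∙ ⁅T.E a, T.E b⁆ := by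
    by_cases ha : a ∈ Set.Icc 1 n
    · by_cases hb : b ∈ Set.Icc 1 n
      · obtain ⟨i, -, hi⟩ := T.exists_basis_eq_E ha
        obtain ⟨j, -, hj⟩ := T.exists_basis_eq_E hb
        rw [← hi, ← hj]
        exact apply_mem_span_lie_of_forall_lt (e := fun i => T.basis (.inl i)) h i j
      · rw [T.E_eq_zero hb, map_zero]
        exact zero_mem _
    · rw [T.E_eq_zero ha, map_zero, LinearMap.zero_apply]
      exact zero_mem _
  choose c hc using fun a b => Submodule.mem_span_singleton.1 (hmem a b)
  exact ⟨c, fun a b => (hc a b).symm⟩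

theorem rescaling_add_eq {φ : twoCochain ℂ T.Alg T.Alg} (hφ : φ ∈ twoCocycle ℂ T.Alg T.Alg)
    {c : ℕ → ℕ → ℂ} (hc : ∀ a b, φ (T.E a) (T.E b) = c a b • ⁅T.E a, T.E b⁆)
    {i j k ij jk : ℕ} {r s : ℂ} (hij : ⁅T.E i, T.E j⁆ = r • T.E ij)
    (hjk : ⁅T.E j, T.E k⁆ = s • T.E jk) (hik : ⁅T.E i, T.E k⁆ = 0)
    (hijk : ⁅⁅T.E i, T.E j⁆, T.E k⁆ ≠ 0) : c i j + c ij k = c j k + c i jk := by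
  refine smul_left_injective ℂ hijk <|
    smul_lie_lie_eq_of_mem_twoCocycle hφ hik ?_ (hc i j) (hc j k) ?_ ?_
  · rw [hc, hik, smul_zero]
  · rw [hij, map_smul, LinearMap.smul_apply, hc, smul_lie, smul_comm]
  · rw [hjk, map_smul, hc, lie_smul, smul_comm]

section Listed

variable {nil : ℕ → ℕ → (Lab n → ℂ)} {p q : ℤ}

theorem lie_E_E (hT : T.listed = listedTable n nil p q) {a b : ℕ}
    (ha : a ∈ Set.Icc 1 n) (hb : b ∈ Set.Icc 1 n) :
    ⁅T.E a, T.E b⁆ = (nil a b - nil b a : Lab n → ℂ) := by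
  rw [← mul_ee n nil p q a b ha hb, ← hT]
  rfl

theorem isWeightBasis (hT : T.listed = listedTable n nil p q) :
    IsWeightBasis T.basis (tableWeight n p q) where
  lie_inl_inr i s := by
    rw [T.basis_inl, tableWeight, ← wtQ_intCast]
    refine Eq.trans ?_ (mul_eq n nil p q (i + 1) s ⟨by omega, i.2⟩)
    rw [← hT]
    rfl
  lie_inr_inr s t := by
    rw [lie_basis, hT]
    exact sub_self _

theorem exists_eq_tableWeight_dotProduct
    (hchain : ∀ i, 2 ≤ i → i + 2 ≤ n → ⁅T.E 1, T.E i⁆ = T.E (i + 1))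
    {μ : ℕ → ℂ} (hμ : d₁₂ ℂ T.Alg T.Alg (T.diagonal μ) = 0) (hlast : μ n = p * μ 1 + q * μ 2)
    (i : Fin n) : μ (i + 1) = tableWeight n p q i ⬝ᵥ ![μ 1, μ 2] := by
  simp only [tableWeight, intWeight, Matrix.vec2_dotProduct, Matrix.cons_val_zero,
    Matrix.cons_val_one]
  split_ifs with hi hin
  · simp [hi]
  · rw [hin, hlast]
  · rw [eq_of_d₁₂_diagonal_eq_zero hchain hμ (by omega) (by omega)]
    push_cast
    ring

theorem subsingleton_adjointH2 (hn : 3 ≤ n) (hT : T.listed = listedTable n nil p q)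
    (hpq : 2 ≤ p + q) (hq : q ≠ 1)
    (hchain : ∀ i, 2 ≤ i → i + 2 ≤ n → ⁅T.E 1, T.E i⁆ = T.E (i + 1))
    (hlast : ∀ μ : ℕ → ℂ, d₁₂ ℂ T.Alg T.Alg (T.diagonal μ) = 0 → μ n = p * μ 1 + q * μ 2)
    (hsat : ∀ a b d, 1 ≤ a → a < b → b ≤ n → 1 ≤ d → d ≤ n →
      intWeight n p q d = intWeight n p q a + intWeight n p q b → ⁅T.E a, T.E b⁆ ≠ 0)
    (hcob : ∀ φ ∈ twoCocycle ℂ T.Alg T.Alg, ∀ c : ℕ → ℕ → ℂ,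
      (∀ a b, φ (T.E a) (T.E b) = c a b • ⁅T.E a, T.E b⁆) →
      ∃ ν : ℕ → ℂ, ∀ a b, 1 ≤ a → a < b → b ≤ n →
        c a b • ⁅T.E a, T.E b⁆ = d₁₂ ℂ T.Alg T.Alg (T.diagonal ν) (T.E a) (T.E b)) :
    Subsingleton (AdjointH2 ℂ T.Alg) := by
  refine (isWeightBasis hT).subsingleton_adjointH2 (tableWeight_injective hpq hq)
    (tableWeight_ne_zero hpq) (fun i j _ => tableWeight_add_ne_zero hpq i j)
    (fun t => eq_zero_of_forall_tableWeight_dotProduct hn) ?_ ?_ ?_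
  · intro i j m hij hm
    rw [T.basis_inl, T.basis_inl]
    refine hsat _ _ (m + 1) (by omega) (Nat.succ_lt_succ hij) j.2 (by omega) m.2 ?_
    exact funext fun s => Int.cast_injective (α := ℂ) <|
      (congrFun hm s).trans (Int.cast_add _ _).symm
  · intro μ hμ
    let μ' : ℕ → ℂ := fun k => if h : k - 1 < n then μ ⟨k - 1, h⟩ else 0
    have hμ' : μ = fun i : Fin n => μ' (i + 1) := by
      funext i
      simp [μ']
    rw [hμ'] at hμ ⊢
    exact ⟨_, exists_eq_tableWeight_dotProduct hchain hμ (hlast μ' hμ)⟩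
  · intro φ hφ hmem
    obtain ⟨c, hc⟩ := exists_apply_E_eq_smul_lie hmem
    obtain ⟨ν, hν⟩ := hcob φ hφ c hc
    refine ⟨fun i => ν (i + 1), fun i j hij => ?_⟩
    rw [T.basis_inl, T.basis_inl, hc]
    exact hν _ _ (by omega) (Nat.succ_lt_succ hij) j.2

end Listed

end LieTable

end Table

section Recurrence

variable {K : Type*} [CommRing K]

/-- The sequence with `μ 1 = μ 2 = 0` and increments `μ (k + 1) - μ k = - α k` from `k = 2` on. -/
def potential (α : ℕ → K) (k : ℕ) : K :=
  -∑ j ∈ Finset.Ico 2 k, α j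

theorem potential_of_le_two (α : ℕ → K) {k : ℕ} (hk : k ≤ 2) : potential α k = 0 := by
  rw [potential, Finset.Ico_eq_empty_of_le hk, Finset.sum_empty, neg_zero]

theorem potential_succ (α : ℕ → K) {k : ℕ} (hk : 2 ≤ k) :
    potential α (k + 1) = potential α k - α k := by
  rw [potential, potential, Finset.sum_Ico_succ_top hk, neg_add, sub_eq_add_neg]

theorem exists_potential_of_add_eq_add {n : ℕ} (hn : 5 ≤ n) {α β : ℕ → K}
    (h : ∀ i, 2 ≤ i → i + 4 ≤ n → α i + β (i + 1) = β i + α (i + 2)) :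
    ∃ μ : ℕ → K, (∀ i, 2 ≤ i → i + 2 ≤ n → α i = μ 1 + μ i - μ (i + 1)) ∧
      ∀ i, 2 ≤ i → i + 3 ≤ n → β i = μ i + μ n - μ (i + 2) := by
  let μ := Function.update (potential α) n (β 2 + potential α 4)
  have hμ {k : ℕ} (hk : k < n) : μ k = potential α k := Function.update_of_ne hk.ne _ _
  have hμn : μ n = β 2 + potential α 4 := Function.update_self _ _ _
  refine ⟨μ, fun i hi hin => ?_, fun i hi hin => ?_⟩
  · rw [hμ (by omega), hμ (by omega), hμ (by omega), potential_succ α hi,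
      potential_of_le_two α one_le_two]
    ring
  · rw [hμn, hμ (by omega), hμ (by omega)]
    induction i, hi using Nat.le_induction with
    | base => rw [potential_of_le_two α le_rfl]; ring
    | succ i hi ih =>
      rw [potential_succ α hi, show i + 1 + 2 = (i + 2) + 1 by ring,
        potential_succ α (by omega : 2 ≤ i + 2)]
      linear_combination ih (by omega) + h i hi (by omega)

theorem exists_potential_of_reflected_add_eq_add {n : ℕ} {α β : ℕ → K}
    (h : ∀ i j, 2 ≤ i → 2 ≤ j → i + 1 + j = n → α i + β (i + 1) = α j + β i) :
    ∃ μ : ℕ → K, (∀ i, 2 ≤ i → i + 2 ≤ n → α i = μ 1 + μ i - μ (i + 1)) ∧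
      ∀ i j, 2 ≤ i → 2 ≤ j → i + j = n → β i = μ i + μ j - μ n := by
  let μ := Function.update (potential α) n (potential α (n - 2) - β 2)
  have hμ {k : ℕ} (hk : k < n) : μ k = potential α k := Function.update_of_ne hk.ne _ _
  have hμn : μ n = potential α (n - 2) - β 2 := Function.update_self _ _ _
  refine ⟨μ, fun i hi hin => ?_, fun i j hi hj hij => ?_⟩
  · rw [hμ (by omega), hμ (by omega), hμ (by omega), potential_succ α hi,
      potential_of_le_two α one_le_two]
    ring
  · rw [hμ (by omega), hμ (by omega), hμn]
    induction i, hi using Nat.le_induction generalizing j with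
    | base =>
      rw [potential_of_le_two α le_rfl, show n - 2 = j by omega]
      ring
    | succ i hi ih =>
      have hstep := ih (j + 1) (by omega) (by omega)
      rw [potential_succ α hj] at hstep
      rw [potential_succ α hi]
      linear_combination hstep + h i j hi hj hij

end Recurrence

section R2

variable {n : ℕ} {hn : 5 ≤ n}

theorem R2_listed : (R2 n hn).listed = listedTable n (nil2 n) (2 : ℤ) (0 : ℤ) := by
  simp only [R2, listed2, Int.cast_ofNat, Int.cast_zero]

theorem R2_lie_one {i : ℕ} (hi : 2 ≤ i) (hin : i + 2 ≤ n) :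
    ⁅(R2 n hn).E 1, (R2 n hn).E i⁆ = (R2 n hn).E (i + 1) := by
  rw [LieTable.lie_E_E R2_listed ⟨by omega, by omega⟩ ⟨by omega, by omega⟩, nil2_sub n _ _ hn,
    if_pos ⟨rfl, hi, hin⟩]
  rfl

theorem R2_lie_last {i : ℕ} (hi : 2 ≤ i) (hin : i + 3 ≤ n) :
    ⁅(R2 n hn).E i, (R2 n hn).E n⁆ = (R2 n hn).E (i + 2) := by
  rw [LieTable.lie_E_E R2_listed ⟨by omega, by omega⟩ ⟨by omega, by omega⟩, nil2_sub n _ _ hn,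
    if_neg (by omega), if_neg (by omega), if_pos ⟨hi, hin, rfl⟩]
  rfl

theorem R2_lie_eq_zero {a b : ℕ} (ha : 1 ≤ a) (hab : a < b) (hbn : b ≤ n)
    (hone : ¬(a = 1 ∧ b + 2 ≤ n)) (hlast : ¬(2 ≤ a ∧ a + 3 ≤ n ∧ b = n)) :
    ⁅(R2 n hn).E a, (R2 n hn).E b⁆ = 0 := by
  rw [LieTable.lie_E_E R2_listed ⟨by omega, by omega⟩ ⟨by omega, by omega⟩, nil2_sub n _ _ hn,
    if_neg (by omega), if_neg (by omega), if_neg (by omega), if_neg (by omega)]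
  rfl

theorem R2_diagonal_derivation_last {μ : ℕ → ℂ}
    (hμ : d₁₂ ℂ (R2 n hn).Alg (R2 n hn).Alg ((R2 n hn).diagonal μ) = 0) : μ n = 2 * μ 1 := by
  have hlast := LieTable.add_eq_of_d₁₂_diagonal_eq_zero hμ
    ((R2_lie_last le_rfl hn).trans (one_smul ℂ _).symm) one_ne_zero ⟨by omega, by omega⟩
  have hfour := LieTable.eq_of_d₁₂_diagonal_eq_zero (fun _ => R2_lie_one) hμ
    (by omega : 2 ≤ 4) hn
  push_cast at hfour
  linear_combination hlast + hfour

theorem R2_lie_ne_zero_of_intWeight_eq {a b d : ℕ} (ha : 1 ≤ a) (hab : a < b) (hbn : b ≤ n)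
    (hd : 1 ≤ d) (hdn : d ≤ n) (h : intWeight n 2 0 d = intWeight n 2 0 a + intWeight n 2 0 b) :
    ⁅(R2 n hn).E a, (R2 n hn).E b⁆ ≠ 0 := by
  have hx := congrFun h 0
  have hy := congrFun h 1
  simp only [intWeight, Pi.add_apply, Matrix.cons_val_zero, Matrix.cons_val_one] at hx hy
  obtain ⟨rfl, hb⟩ | ⟨ha, han, rfl⟩ :
      (a = 1 ∧ b + 2 ≤ n) ∨ (2 ≤ a ∧ a + 3 ≤ n ∧ b = n) := by
    split_ifs at hx hy <;> omega
  · rw [R2_lie_one hab hb]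
    exact LieTable.E_ne_zero _ ⟨by omega, by omega⟩
  · rw [R2_lie_last ha han]
    exact LieTable.E_ne_zero _ ⟨by omega, by omega⟩

theorem R2_rescaling_add_eq {φ : twoCochain ℂ (R2 n hn).Alg (R2 n hn).Alg}
    (hφ : φ ∈ twoCocycle ℂ (R2 n hn).Alg (R2 n hn).Alg) {c : ℕ → ℕ → ℂ}
    (hc : ∀ a b, φ ((R2 n hn).E a) ((R2 n hn).E b) =
      c a b • ⁅(R2 n hn).E a, (R2 n hn).E b⁆)
    {i : ℕ} (hi : 2 ≤ i) (hin : i + 4 ≤ n) : c 1 i + c (i + 1) n = c i n + c 1 (i + 2) := by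
  refine LieTable.rescaling_add_eq hφ hc ((R2_lie_one hi (by omega)).trans (one_smul ℂ _).symm)
    ((R2_lie_last hi (by omega)).trans (one_smul ℂ _).symm)
    (R2_lie_eq_zero le_rfl (by omega) le_rfl (by omega) (by omega)) ?_
  rw [R2_lie_one hi (by omega), R2_lie_last (by omega) (by omega)]
  exact LieTable.E_ne_zero _ ⟨by omega, by omega⟩

theorem R2_exists_diagonal {φ : twoCochain ℂ (R2 n hn).Alg (R2 n hn).Alg}
    (hφ : φ ∈ twoCocycle ℂ (R2 n hn).Alg (R2 n hn).Alg) {c : ℕ → ℕ → ℂ}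
    (hc : ∀ a b, φ ((R2 n hn).E a) ((R2 n hn).E b) =
      c a b • ⁅(R2 n hn).E a, (R2 n hn).E b⁆) :
    ∃ μ : ℕ → ℂ, ∀ a b, 1 ≤ a → a < b → b ≤ n → c a b • ⁅(R2 n hn).E a, (R2 n hn).E b⁆ =
      d₁₂ ℂ _ _ ((R2 n hn).diagonal μ) ((R2 n hn).E a) ((R2 n hn).E b) := by
  obtain ⟨μ, hone, hlast⟩ := exists_potential_of_add_eq_add (α := c 1) (β := (c · n)) hn
    fun _ => R2_rescaling_add_eq hφ hc
  refine ⟨μ, fun a b ha hab hbn => ?_⟩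
  by_cases h₁ : a = 1 ∧ b + 2 ≤ n
  · obtain ⟨rfl, hb⟩ := h₁
    rw [LieTable.d₁₂_diagonal_E ((R2_lie_one hab hb).trans (one_smul ℂ _).symm), hone b hab hb]
  by_cases h₂ : 2 ≤ a ∧ a + 3 ≤ n ∧ b = n
  · obtain ⟨ha, han, rfl⟩ := h₂
    rw [LieTable.d₁₂_diagonal_E ((R2_lie_last ha han).trans (one_smul ℂ _).symm), hlast a ha han]
  have hzero := R2_lie_eq_zero (hn := hn) ha hab hbn h₁ h₂
  rw [LieTable.d₁₂_diagonal_E (d := 0) (hzero.trans (zero_smul ℂ _).symm), hzero, smul_zero,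
    smul_zero]

theorem subsingleton_adjointH2_R2 : Subsingleton (AdjointH2 ℂ (R2 n hn).Alg) := by
  refine LieTable.subsingleton_adjointH2 (by omega) R2_listed (by norm_num) (by norm_num)
    (fun _ => R2_lie_one) (fun μ hμ => ?_) (fun _ _ _ => R2_lie_ne_zero_of_intWeight_eq)
    fun φ hφ c => R2_exists_diagonal hφ
  rw [R2_diagonal_derivation_last hμ]
  push_cast
  ring

end R2

section R1

variable {n : ℕ} {hn : 5 ≤ n} {hodd : Odd n}

theorem R1_listed : (R1 n hn hodd).listed = listedTable n (nil1 n) (n - 4 : ℤ) (2 : ℤ) := by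
  simp only [R1, listed1, Int.cast_sub, Int.cast_natCast, Int.cast_ofNat]

theorem R1_lie_one {i : ℕ} (hi : 2 ≤ i) (hin : i + 2 ≤ n) :
    ⁅(R1 n hn hodd).E 1, (R1 n hn hodd).E i⁆ = (R1 n hn hodd).E (i + 1) := by
  rw [LieTable.lie_E_E R1_listed ⟨by omega, by omega⟩ ⟨by omega, by omega⟩, nil1_sub n _ _ hodd,
    if_pos ⟨rfl, hi, hin⟩]
  rfl

theorem R1_lie_of_add_eq {i j : ℕ} (hi : 2 ≤ i) (hj : 2 ≤ j) (hij : i + j = n) :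
    ⁅(R1 n hn hodd).E i, (R1 n hn hodd).E j⁆ = (-1 : ℂ) ^ i • (R1 n hn hodd).E n := by
  rw [LieTable.lie_E_E R1_listed ⟨by omega, by omega⟩ ⟨by omega, by omega⟩, nil1_sub n _ _ hodd,
    if_neg (by omega), if_neg (by omega), if_pos ⟨hi, hj, hij⟩]
  rfl

theorem R1_lie_eq_zero {a b : ℕ} (ha : a ∈ Set.Icc 1 n) (hb : b ∈ Set.Icc 1 n)
    (hone : ¬(a = 1 ∧ 2 ≤ b ∧ b + 2 ≤ n)) (hone' : ¬(b = 1 ∧ 2 ≤ a ∧ a + 2 ≤ n))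
    (hadd : ¬(2 ≤ a ∧ 2 ≤ b ∧ a + b = n)) :
    ⁅(R1 n hn hodd).E a, (R1 n hn hodd).E b⁆ = 0 := by
  rw [LieTable.lie_E_E R1_listed ha hb, nil1_sub n _ _ hodd, if_neg hone, if_neg hone',
    if_neg hadd]
  rfl

theorem R1_diagonal_derivation_last {μ : ℕ → ℂ}
    (hμ : d₁₂ ℂ (R1 n hn hodd).Alg (R1 n hn hodd).Alg ((R1 n hn hodd).diagonal μ) = 0) :
    μ n = (n - 4) * μ 1 + 2 * μ 2 := by
  have hadd := LieTable.add_eq_of_d₁₂_diagonal_eq_zero hμ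
    (R1_lie_of_add_eq (i := 2) (j := n - 2) le_rfl (by omega) (by omega)) (by norm_num)
    ⟨by omega, le_rfl⟩
  have hchain := LieTable.eq_of_d₁₂_diagonal_eq_zero (fun _ => R1_lie_one) hμ
    (by omega : 2 ≤ n - 2) (by omega)
  push_cast [show 2 ≤ n by omega] at hchain
  linear_combination hchain - hadd

theorem R1_lie_ne_zero_of_intWeight_eq {a b d : ℕ} (ha : 1 ≤ a) (hab : a < b) (hbn : b ≤ n)
    (hd : 1 ≤ d) (hdn : d ≤ n)
    (h : intWeight n (n - 4) 2 d = intWeight n (n - 4) 2 a + intWeight n (n - 4) 2 b) :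
    ⁅(R1 n hn hodd).E a, (R1 n hn hodd).E b⁆ ≠ 0 := by
  have hx := congrFun h 0
  have hy := congrFun h 1
  simp only [intWeight, Pi.add_apply, Matrix.cons_val_zero, Matrix.cons_val_one] at hx hy
  obtain ⟨rfl, hb⟩ | ⟨ha, hadd⟩ : (a = 1 ∧ b + 2 ≤ n) ∨ (2 ≤ a ∧ a + b = n) := by
    split_ifs at hx hy <;> omega
  · rw [R1_lie_one hab hb]
    exact LieTable.E_ne_zero _ ⟨by omega, by omega⟩
  · rw [R1_lie_of_add_eq ha (by omega) hadd]
    exact smul_ne_zero (by simp) (LieTable.E_ne_zero _ ⟨by omega, le_rfl⟩)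

theorem R1_rescaling_add_eq {φ : twoCochain ℂ (R1 n hn hodd).Alg (R1 n hn hodd).Alg}
    (hφ : φ ∈ twoCocycle ℂ (R1 n hn hodd).Alg (R1 n hn hodd).Alg) {c : ℕ → ℕ → ℂ}
    (hc : ∀ a b, φ ((R1 n hn hodd).E a) ((R1 n hn hodd).E b) =
      c a b • ⁅(R1 n hn hodd).E a, (R1 n hn hodd).E b⁆)
    {i j : ℕ} (hi : 2 ≤ i) (hj : 2 ≤ j) (hij : i + 1 + j = n) :
    c 1 i + c (i + 1) j = c 1 j + c i (j + 1) := by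
  have hone : ⁅(R1 n hn hodd).E i, (R1 n hn hodd).E 1⁆ = (-1 : ℂ) • (R1 n hn hodd).E (i + 1) := by
    rw [← lie_skew, R1_lie_one hi (by omega), neg_one_smul]
  have hlie_ne : ⁅⁅(R1 n hn hodd).E i, (R1 n hn hodd).E 1⁆, (R1 n hn hodd).E j⁆ ≠ 0 := by
    rw [hone, smul_lie, R1_lie_of_add_eq (by omega) hj hij]
    exact smul_ne_zero (by simp)
      (smul_ne_zero (by simp) (LieTable.E_ne_zero _ ⟨by omega, le_rfl⟩))
  have hcomm : c i 1 = c 1 i := LieTable.rescaling_comm hc fun h => hlie_ne (by rw [h, zero_lie])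
  rw [← hcomm]
  exact LieTable.rescaling_add_eq hφ hc hone
    ((R1_lie_one hj (by omega)).trans (one_smul ℂ _).symm)
    (R1_lie_eq_zero ⟨by omega, by omega⟩ ⟨by omega, by omega⟩ (by omega) (by omega) (by omega))
    hlie_ne

theorem R1_exists_diagonal {φ : twoCochain ℂ (R1 n hn hodd).Alg (R1 n hn hodd).Alg}
    (hφ : φ ∈ twoCocycle ℂ (R1 n hn hodd).Alg (R1 n hn hodd).Alg) {c : ℕ → ℕ → ℂ}
    (hc : ∀ a b, φ ((R1 n hn hodd).E a) ((R1 n hn hodd).E b) =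
      c a b • ⁅(R1 n hn hodd).E a, (R1 n hn hodd).E b⁆) :
    ∃ μ : ℕ → ℂ, ∀ a b, 1 ≤ a → a < b → b ≤ n →
      c a b • ⁅(R1 n hn hodd).E a, (R1 n hn hodd).E b⁆ =
        d₁₂ ℂ _ _ ((R1 n hn hodd).diagonal μ) ((R1 n hn hodd).E a) ((R1 n hn hodd).E b) := by
  have hrec (i j : ℕ) (hi : 2 ≤ i) (hj : 2 ≤ j) (hij : i + 1 + j = n) :
      c 1 i + c (i + 1) (n - (i + 1)) = c 1 j + c i (n - i) := by
    rw [show n - (i + 1) = j by omega, show n - i = j + 1 by omega]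
    exact R1_rescaling_add_eq hφ hc hi hj hij
  obtain ⟨μ, hone, hadd⟩ := exists_potential_of_reflected_add_eq_add (α := c 1)
    (β := fun i => c i (n - i)) hrec
  refine ⟨μ, fun a b ha hab hbn => ?_⟩
  by_cases h₁ : a = 1 ∧ b + 2 ≤ n
  · obtain ⟨rfl, hb⟩ := h₁
    rw [LieTable.d₁₂_diagonal_E ((R1_lie_one hab hb).trans (one_smul ℂ _).symm), hone b hab hb]
  by_cases h₂ : 2 ≤ a ∧ a + b = n
  · obtain ⟨ha, hsum⟩ := h₂
    rw [LieTable.d₁₂_diagonal_E (R1_lie_of_add_eq ha (by omega) hsum),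
      ← hadd a b ha (by omega) hsum, show n - a = b by omega]
  have hzero := R1_lie_eq_zero (hn := hn) (hodd := hodd) (a := a) (b := b) ⟨by omega, by omega⟩
    ⟨by omega, by omega⟩ (by omega) (by omega) (by omega)
  rw [LieTable.d₁₂_diagonal_E (d := 0) (hzero.trans (zero_smul ℂ _).symm), hzero, smul_zero,
    smul_zero]

theorem subsingleton_adjointH2_R1 : Subsingleton (AdjointH2 ℂ (R1 n hn hodd).Alg) := by
  refine LieTable.subsingleton_adjointH2 (by omega) R1_listed (by omega) (by norm_num)
    (fun _ => R1_lie_one) (fun μ hμ => ?_) (fun _ _ _ => R1_lie_ne_zero_of_intWeight_eq)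
    fun φ hφ c => R1_exists_diagonal hφ
  rw [R1_diagonal_derivation_last hμ]
  push_cast
  ring

end R1

theorem mainTheorem4 :
    (∀ (n : ℕ) (hn : 5 ≤ n) (hodd : Odd n), Subsingleton (AdjointH2 ℂ (R1 n hn hodd).Alg)) ∧
    (∀ (n : ℕ) (hn : 5 ≤ n), Subsingleton (AdjointH2 ℂ (R2 n hn).Alg)) :=
  ⟨fun _ _ _ => subsingleton_adjointH2_R1, fun _ _ => subsingleton_adjointH2_R2⟩
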